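/- Let $G$ be a group and let $H_1,\dots,H_n$ be subgroups of $G$ such that the collection $\{H_1,\dots,H_n\}$ is hyperbolically embedded in $G$. Then the extension problem for $\{H_1,\dots,H_n\}$ and $G$ is solvable. That is, for every collection of isometric actions of $H_i$ on metric spaces $R_i$, $i=1,\dots,n$, there are a metric space $S$ and an isometric action of $G$ on $S$ such that for each $i$ there is a map $f_i\colon R_i\to S$ which is - coarsely $H_i$-equivariant: $\sup_{h\in H_i} d_S(f_i(hx),hf_i(x))<\infty$ for every $x\in R_i$; and - a quasi-isometric embedding: there is a constant $C>0$ with $\frac1C d_{R_i}(x,y)-C\le d_S(f_i(x),f_i(y))\le C\,d_{R_i}(x,y)+C$ for all $x,y\in R_i$. Here all metrics take finite values, and the collection $\{H_1,\dots,H_n\}$ is called hyperbolically embedded in $G$ if there is a (possibly infinite) subset $X\subseteq G$ with $X=X^{-1}$ such that the following hold. (a) $G$ is generated by $X\cup H_1\cup\dots\cup H_n$, and the Cayley graph $\Gamma$ of $G$ with respect to the disjoint union $X\sqcup H_1\sqcup\dots\sqcup H_n$ (with an edge from $g$ to $ga$ labelled by $a$ for every $g\in G$ and every letter $a$ of this alphabet)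 is hyperbolic, i.e. for some $\delta\ge 0$, in every geodesic triangle each side lies in the $\delta$-neighbourhood of the union of the other two. (b) For every $i$ and every $h\in H_i$, each ball $\{k\in H_i : d_i(h,k)\le r\}$ with $r<\infty$ is finite. Here $d_i(h,k)\in[0,\infty]$ is the length of a shortest path from $h$ to $k$ in the graph obtained from $\Gamma$ by removing all edges that start at an element of $H_i$ and are labelled by a letter from the copy of $H_i$ in the alphabet, and $d_i(h,k)=\infty$ if there is no such path. -/

import Mathlib

universe u v w

/-! ### Hyperbolic graphs -/

/-- A graph is hyperbolic if, for some `δ`, every geodesic triangle is `δ`-slim: each point of a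
side is `δ`-close to the union of the other two sides. The triangles here have vertices of the graph
as corners and shortest walks as sides. Up to changing `δ`, this is the slim triangle condition for
the graph seen as a geodesic metric space with edges of length one. -/
def SimpleGraph.IsGromovHyperbolic {V : Type u} (Γ : SimpleGraph V) : Prop :=
  ∃ δ : ℕ, ∀ (x y z : V) (p : Γ.Walk x y) (q : Γ.Walk y z) (r : Γ.Walk z x),
    p.length = Γ.dist x y → q.length = Γ.dist y z → r.length = Γ.dist z x →
      ∀ a ∈ p.support, ∃ b, (b ∈ q.support ∨ b ∈ r.support) ∧ Γ.dist a b ≤ δ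

/-! ### Hyperbolically embedded collections of subgroups -/

namespace HypEmb

variable {G : Type u} [Group G] {ι : Type w}

/-- The alphabet `X ⊔ ⨆ᵢ Hᵢ`. The unions are disjoint: an element of `G` lying in several of the
sets `X`, `Hᵢ` is represented by several letters. -/
abbrev Letter (X : Set G) (H : ι → Subgroup G) : Type (max u w) :=
  X ⊕ (Σ i, H i)

/-- The element of `G` that a letter represents. -/
def Letter.val {X : Set G} {H : ι → Subgroup G} : Letter X H → G
  | Sum.inl x => x
  | Sum.inr h => h.2

/-- The Cayley graph `Γ(G, X ⊔ 𝓗)`: for every vertex `g` and every letter `a` there is an edge from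
`g` to `g * a`. Loops and multiplicities of edges are forgotten, which does not change the
distances between vertices. -/
def cayley (X : Set G) (H : ι → Subgroup G) : SimpleGraph G :=
  SimpleGraph.fromRel fun g k => ∃ a : Letter X H, g * a.val = k

/-- The edge of `Γ(G, X ⊔ 𝓗)` that starts at `g` and is labelled by `a` is an edge of the subgraph
`Γ(Hᵢ, Hᵢ)`: it starts at an element of `Hᵢ` and its label is a letter from the copy of `Hᵢ` in the
alphabet. -/
def IsSubgroupEdge {X : Set G} {H : ι → Subgroup G} (i : ι) (g : G) (a : Letter X H) : Prop :=
  g ∈ H i ∧ ∃ h : H i, a = Sum.inr ⟨i, h⟩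

/-- The graph `Δᵢ`, obtained from `Γ(G, X ⊔ 𝓗)` by removing all edges (but no vertices) of
`Γ(Hᵢ, Hᵢ)`. An edge with the same end points but labelled by a letter from `X` or from another
subgroup `Hⱼ` is kept. -/
def deletedCayley (X : Set G) (H : ι → Subgroup G) (i : ι) : SimpleGraph G :=
  SimpleGraph.fromRel fun g k => ∃ a : Letter X H, g * a.val = k ∧ ¬ IsSubgroupEdge i g a

/-- The extended metric `dᵢ` on `Hᵢ`: the length of a shortest path in `Δᵢ`, and `⊤` if there is
none. -/
noncomputable def relDist (X : Set G) (H : ι → Subgroup G) (i : ι) (h k : H i) : ℕ∞ :=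
  (deletedCayley X H i).edist (h : G) (k : G)

/-- The collection `H` is hyperbolically embedded in `G` with respect to the symmetric set `X`. -/
structure IsHyperbolicallyEmbeddedWrt (X : Set G) (H : ι → Subgroup G) : Prop where
  symm : ∀ x ∈ X, x⁻¹ ∈ X
  generates : Subgroup.closure (X ∪ ⋃ i, (H i : Set G)) = ⊤
  hyperbolic : (cayley X H).IsGromovHyperbolic
  proper : ∀ (i : ι) (h : H i) (r : ℕ), {k : H i | relDist X H i h k ≤ r}.Finite

/-- The collection `H` is hyperbolically embedded in `G`. -/
def IsHyperbolicallyEmbedded (H : ι → Subgroup G) : Prop :=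
  ∃ X : Set G, IsHyperbolicallyEmbeddedWrt X H

/-! ### The extension problem -/

/-- A map `f : R → S` between spaces acted upon by `K` is coarsely `K`-equivariant if
`sup_k d(f(k x), k f(x)) < ∞` for every point `x`. -/
def IsCoarselyEquivariant (K : Type*) [Group K] {R S : Type*} [MulAction K R] [MetricSpace S]
    [MulAction K S] (f : R → S) : Prop :=
  ∀ x : R, BddAbove (Set.range fun k : K => dist (f (k • x)) (k • f x))

/-- Quasi-isometric embeddings of metric spaces. -/
def IsQuasiIsometricEmbedding {R S : Type*} [MetricSpace R] [MetricSpace S] (f : R → S) : Prop :=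
  ∃ C : ℝ, 0 < C ∧ ∀ x y : R,
    1 / C * dist x y - C ≤ dist (f x) (f y) ∧ dist (f x) (f y) ≤ C * dist x y + C

/-- The isometric action of `G` on `S` is an extension of the given collection of isometric
actions of the subgroups `H i` on the metric spaces `R i`. -/
def IsExtension (H : ι → Subgroup G)
    (R : ι → Type v) [∀ i, MetricSpace (R i)] [∀ i, MulAction (H i) (R i)]
    [∀ i, IsIsometricSMul (H i) (R i)]
    (S : Type*) [MetricSpace S] [MulAction G S] [IsIsometricSMul G S] : Prop :=
  ∀ i, ∃ f : R i → S, IsCoarselyEquivariant (H i) f ∧ IsQuasiIsometricEmbedding f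

/-- The extension problem for the collection `H` of subgroups of `G` is solvable: every collection
of isometric actions of the subgroups `H i` on metric spaces has an extension to an isometric
action of `G` on a metric space. -/
def ExtensionProblemSolvable (H : ι → Subgroup G) : Prop :=
  ∀ (R : ι → Type v) [∀ i, MetricSpace (R i)] [∀ i, MulAction (H i) (R i)]
    [∀ i, IsIsometricSMul (H i) (R i)],
    ∃ (S : Type (max u v w)) (_ : MetricSpace S) (_ : MulAction G S) (_ : IsIsometricSMul G S),
      IsExtension H R S

end HypEmb

/-! ### Geodesics in graphs -/

namespace SimpleGraph

variable {V : Type*} {Γ Δ : SimpleGraph V}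

/-! Project `G` to each `H k` by nearest points in the Cayley graph. Slim triangles make this
coarsely Lipschitz towards `relDist`: an edge that is not a subgroup edge of `H k` has projections
at bounded relative distance (`edist_nearest_le`). Relative balls are finite, so such an edge moves
a projected base point of `R k` by a bounded amount.

A point `(i, g, x)` of `G × R i` has a coordinate in every `R k`: the point `g • x` if `i = k` and
`g ∈ H k`, otherwise the projection of `g` applied to the base point. The supremum over `k` and all
translates of the coordinate distances is a `G`-invariant pseudometric, finite because right
multiplication by a fixed element moves projected base points boundedly. The map `x ↦ (i, 1, x)` is
isometric, and coarsely equivariant because `g` and `g * h` are joined by an edge labelled `h`. -/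

theorem Connected.dist_add_dist_of_mem_geodesic (hΓ : Γ.Connected) {u v z : V} (p : Γ.Walk u v)
    (hp : p.length = Γ.dist u v) (hz : z ∈ p.support) :
    Γ.dist u z + Γ.dist z v = Γ.dist u v := by
  classical
  apply le_antisymm _ hΓ.dist_triangle
  rw [← hp, ← p.take_spec hz, Walk.length_append]
  exact add_le_add (dist_le _) (dist_le _)

theorem Connected.exists_mem_geodesic_dist_eq (hΓ : Γ.Connected) {u v : V} (p : Γ.Walk u v)
    (hp : p.length = Γ.dist u v) {t : ℕ} (ht : t ≤ Γ.dist u v) :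
    ∃ a ∈ p.support, Γ.dist u a = t := by
  refine ⟨p.getVert t, p.getVert_mem_support t, ?_⟩
  have h₁ : Γ.dist u (p.getVert t) ≤ t := (dist_le (p.take t)).trans (by simp)
  have h₂ : Γ.dist (p.getVert t) v ≤ p.length - t := (dist_le (p.drop t)).trans (by simp)
  have h₃ := hΓ.dist_triangle (u := u) (v := p.getVert t) (w := v)
  omega

/-- If `Δ` contains all edges of `Γ` but those with both end points in `A`, then a geodesic of `Γ`
that is not longer than the distance from its origin to `A` survives in `Δ`. -/
theorem Connected.edist_le_of_forall_dist_le (hΓ : Γ.Connected) {A : Set V}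
    (hΔ : ∀ x y, Γ.Adj x y → ¬ (x ∈ A ∧ y ∈ A) → Δ.Adj x y) {a b : V}
    (hab : ∀ z ∈ A, Γ.dist a b ≤ Γ.dist a z) : Δ.edist a b ≤ Γ.dist a b := by
  obtain ⟨p, hp⟩ := hΓ.exists_walk_length_eq_dist a b
  -- The geodesic can meet `A` only at its end `b`, so none of its edges has both ends in `A`.
  have key : ∀ z ∈ p.support, z ∈ A → z = b := fun z hz hzA => by
    have h₁ := hΓ.dist_add_dist_of_mem_geodesic p hp hz
    have h₂ := hab z hzA
    exact hΓ.dist_eq_zero_iff.1 (by omega)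
  have hedge : ∀ e ∈ p.edges, e ∈ Δ.edgeSet := by
    intro e
    induction e with | _ x y
    intro he
    have hxy : Γ.Adj x y := p.edges_subset_edgeSet he
    refine hΔ x y hxy fun h => hxy.ne ?_
    rw [key x (p.fst_mem_support_of_mem_edges he) h.1,
      key y (p.snd_mem_support_of_mem_edges he) h.2]
  rw [← hp, ← Walk.length_transfer p hedge]
  exact edist_le _

/-- Nearest point projection to a set of diameter at most one in a hyperbolic graph: the nearest
points to the end points of an edge are joined by a short path that avoids the edges of the set. -/
theorem Connected.edist_nearest_le (hΓ : Γ.Connected) {δ : ℕ}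
    (hδ : ∀ (x y z : V) (p : Γ.Walk x y) (q : Γ.Walk y z) (r : Γ.Walk z x),
      p.length = Γ.dist x y → q.length = Γ.dist y z → r.length = Γ.dist z x →
        ∀ a ∈ p.support, ∃ b, (b ∈ q.support ∨ b ∈ r.support) ∧ Γ.dist a b ≤ δ)
    {A : Set V} (hA : ∀ x ∈ A, ∀ y ∈ A, Γ.dist x y ≤ 1)
    (hΔ : ∀ x y, Γ.Adj x y → ¬ (x ∈ A ∧ y ∈ A) → Δ.Adj x y)
    {g g' p p' : V} (hgg' : Γ.dist g g' ≤ 1) (hgg'Δ : Δ.edist g g' ≤ 1)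
    (hp : p ∈ A) (hgp : ∀ z ∈ A, Γ.dist g p ≤ Γ.dist g z)
    (hp' : p' ∈ A) (hgp' : ∀ z ∈ A, Γ.dist g' p' ≤ Γ.dist g' z) :
    Δ.edist p p' ≤ (8 * δ + 10 : ℕ) := by
  have hpg : Δ.edist g p ≤ Γ.dist g p := hΓ.edist_le_of_forall_dist_le hΔ hgp
  have hpg' : Δ.edist g' p' ≤ Γ.dist g' p' := hΓ.edist_le_of_forall_dist_le hΔ hgp'
  have hlt : Γ.dist g' p' ≤ Γ.dist g p + 1 := by
    have h₁ := hgp' p hp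
    have h₂ := hΓ.dist_triangle (u := g') (v := g) (w := p)
    rw [dist_comm (u := g') (v := g)] at h₂
    omega
  -- Close to `A`, the detour through `g` and `g'` has length at most `(4δ + 4) + 1 + (4δ + 5)`.
  by_cases hshort : Γ.dist g p ≤ 4 * δ + 4
  · calc Δ.edist p p' ≤ Δ.edist p g + (Δ.edist g g' + Δ.edist g' p') :=
          Δ.edist_triangle.trans (add_le_add_right Δ.edist_triangle _)
      _ ≤ (Γ.dist g p : ℕ∞) + (1 + Γ.dist g' p') := by
          rw [edist_comm (u := p)]
          gcongr
      _ ≤ (8 * δ + 10 : ℕ) := by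
          norm_cast
          omega
  -- Far from `A`, the quadrilateral `p, g, g', p'` is cut by the diagonal `γ` into two slim
  -- triangles. The point `a` at distance `2δ + 2` from `p` is too far from the short sides `φ` and
  -- `ε`, so it is `2δ`-close to some `b` on `β`. A geodesic from `a` to `b` is too short to reach
  -- `A`.
  · obtain ⟨α, hα⟩ := hΓ.exists_walk_length_eq_dist p g
    obtain ⟨γ, hγ⟩ := hΓ.exists_walk_length_eq_dist g p'
    obtain ⟨φ, hφ⟩ := hΓ.exists_walk_length_eq_dist p' p
    obtain ⟨ε, hε⟩ := hΓ.exists_walk_length_eq_dist g' g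
    obtain ⟨β, hβ⟩ := hΓ.exists_walk_length_eq_dist p' g'
    obtain ⟨a, haα, hat⟩ := hΓ.exists_mem_geodesic_dist_eq α hα (t := 2 * δ + 2)
      (by rw [dist_comm]; omega)
    have hag := hΓ.dist_add_dist_of_mem_geodesic α hα haα
    have haA : ∀ z ∈ A, 2 * δ + 2 ≤ Γ.dist a z := fun z hz => by
      have h₁ := hgp z hz
      have h₂ := hΓ.dist_triangle (u := g) (v := a) (w := z)
      rw [dist_comm (u := g) (v := a), dist_comm (u := g) (v := p)] at *
      omega
    obtain ⟨b₀, hb₀, hab₀⟩ := hδ _ _ _ α γ φ hα hγ hφ a haα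
    have hb₀γ : b₀ ∈ γ.support := by
      refine hb₀.resolve_right fun h => ?_
      have h₁ := hΓ.dist_add_dist_of_mem_geodesic φ hφ h
      have h₂ := hA p' hp' p hp
      have h₃ := haA p hp
      have h₄ := hΓ.dist_triangle (u := a) (v := b₀) (w := p)
      omega
    obtain ⟨b, hb, hb₀b⟩ := hδ _ _ _ γ β ε hγ hβ hε b₀ hb₀γ
    have hab : Γ.dist a b ≤ 2 * δ := by
      have := hΓ.dist_triangle (u := a) (v := b₀) (w := b)
      omega
    have hbβ : b ∈ β.support := by
      refine hb.resolve_right fun h => ?_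
      have h₁ := hΓ.dist_add_dist_of_mem_geodesic ε hε h
      have h₂ := hΓ.dist_triangle (u := a) (v := b) (w := g)
      rw [dist_comm (u := g') (v := g), dist_comm (u := g) (v := p)] at *
      omega
    have hbp' := hΓ.dist_add_dist_of_mem_geodesic β hβ hbβ
    have hbA : ∀ z ∈ A, Γ.dist b p' ≤ Γ.dist b z := fun z hz => by
      have h₁ := hgp' z hz
      have h₂ := hΓ.dist_triangle (u := g') (v := b) (w := z)
      rw [dist_comm (u := g') (v := b), dist_comm (u := g') (v := p')] at *
      rw [dist_comm (u := b) (v := p')]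
      omega
    have e₁ : Δ.edist a p ≤ Γ.dist a p :=
      hΓ.edist_le_of_forall_dist_le hΔ fun z hz => by
        rw [dist_comm, hat]
        exact haA z hz
    have e₂ : Δ.edist a b ≤ Γ.dist a b :=
      hΓ.edist_le_of_forall_dist_le hΔ fun z hz => (hab.trans (by omega)).trans (haA z hz)
    have e₃ : Δ.edist b p' ≤ Γ.dist b p' := hΓ.edist_le_of_forall_dist_le hΔ hbA
    have hbp : Γ.dist b p' ≤ 4 * δ + 2 := by
      have h₁ := hbA p hp
      have h₂ := hΓ.dist_triangle (u := b) (v := a) (w := p)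
      rw [dist_comm (u := b) (v := a), dist_comm (u := a) (v := p)] at h₂
      omega
    calc Δ.edist p p' ≤ Δ.edist p a + (Δ.edist a b + Δ.edist b p') :=
          Δ.edist_triangle.trans (add_le_add_right Δ.edist_triangle _)
      _ ≤ (Γ.dist a p : ℕ∞) + (Γ.dist a b + Γ.dist b p') := by
          rw [edist_comm (u := p)]
          gcongr
      _ ≤ (8 * δ + 10 : ℕ) := by
          rw [dist_comm (u := a) (v := p)]
          norm_cast
          omega

end SimpleGraph

namespace HypEmb

variable {G : Type u} [Group G] {ι : Type w}

/-! ### Projections to hyperbolically embedded subgroups -/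

section Cayley

variable {X : Set G} {H : ι → Subgroup G}

theorem cayley_adj_mul {g : G} (a : Letter X H) (h : g ≠ g * a.val) :
    (cayley X H).Adj g (g * a.val) :=
  ⟨h, Or.inl ⟨a, rfl⟩⟩

theorem dist_cayley_mul_le_one (g : G) (a : Letter X H) :
    (cayley X H).dist g (g * a.val) ≤ 1 := by
  by_cases h : g = g * a.val
  · rw [← h]
    simp
  · exact (SimpleGraph.dist_eq_one_iff_adj.2 (cayley_adj_mul a h)).le

theorem edist_deletedCayley_mul_le_one {i : ι} {g : G} {a : Letter X H}
    (ha : ¬ IsSubgroupEdge i g a) : (deletedCayley X H i).edist g (g * a.val) ≤ 1 := by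
  rw [SimpleGraph.edist_le_one_iff_adj_or_eq]
  by_cases h : g = g * a.val
  · exact Or.inr h
  · exact Or.inl ⟨h, Or.inl ⟨a, rfl, ha⟩⟩

theorem deletedCayley_adj_of_not_mem {i : ι} {x y : G} (h : (cayley X H).Adj x y)
    (hxy : ¬ (x ∈ (H i : Set G) ∧ y ∈ (H i : Set G))) : (deletedCayley X H i).Adj x y := by
  have key : ∀ x y : G, ¬ (x ∈ H i ∧ y ∈ H i) → (∃ a : Letter X H, x * a.val = y) →
      ∃ a : Letter X H, x * a.val = y ∧ ¬ IsSubgroupEdge i x a := by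
    rintro x y hxy ⟨a, rfl⟩
    refine ⟨a, rfl, ?_⟩
    rintro ⟨hx, h, rfl⟩
    exact hxy ⟨hx, mul_mem hx h.2⟩
  exact ⟨h.1, h.2.imp (key x y hxy) (key y x fun h' => hxy h'.symm)⟩

theorem connected_cayley (hgen : Subgroup.closure (X ∪ ⋃ i, (H i : Set G)) = ⊤) :
    (cayley X H).Connected := by
  have hstep : ∀ (g : G) (a : Letter X H), (cayley X H).Reachable g (g * a.val) := fun g a => by
    by_cases h : g = g * a.val
    · rw [← h]
    · exact (cayley_adj_mul a h).reachable
  have key : ∀ u ∈ Subgroup.closure (X ∪ ⋃ i, (H i : Set G)),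
      ∀ g, (cayley X H).Reachable g (g * u) := by
    intro u hu
    induction hu using Subgroup.closure_induction with
    | mem x hx =>
      rcases hx with hx | hx
      · exact fun g => hstep g (Sum.inl ⟨x, hx⟩)
      · obtain ⟨i, hi⟩ := Set.mem_iUnion.1 hx
        exact fun g => hstep g (Sum.inr ⟨i, x, hi⟩)
    | one => simp
    | mul x y _ _ hx hy =>
      intro g
      rw [← mul_assoc]
      exact (hx g).trans (hy _)
    | inv x _ hx =>
      intro g
      simpa using (hx (g * x⁻¹)).symm
  have : Nonempty G := ⟨1⟩
  refine ⟨fun g k => ?_⟩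
  simpa using key (g⁻¹ * k) (hgen ▸ Subgroup.mem_top _) g

/-- Left translation by `H i` permutes the removed edges. This lets finiteness of the relative balls
around `1` control all pairs. -/
theorem edist_deletedCayley_mul_left_le {i : ι} (h : H i) (x y : G) :
    (deletedCayley X H i).edist (h * x) (h * y) ≤ (deletedCayley X H i).edist x y := by
  have key : ∀ x y : G, (∃ a : Letter X H, x * a.val = y ∧ ¬ IsSubgroupEdge i x a) →
      ∃ a : Letter X H, h * x * a.val = h * y ∧ ¬ IsSubgroupEdge i (h * x) a := by
    rintro x y ⟨a, rfl, ha⟩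
    refine ⟨a, mul_assoc _ _ _, fun h' => ha ⟨?_, h'.2⟩⟩
    exact ((H i).mul_mem_cancel_left h.2).1 h'.1
  let φ : deletedCayley X H i →g deletedCayley X H i :=
    { toFun := fun x => h * x
      map_rel' := fun {x y} hxy =>
        ⟨fun h' => hxy.1 (mul_left_cancel h'), hxy.2.imp (key x y) (key y x)⟩ }
  by_cases ht : (deletedCayley X H i).edist x y = ⊤
  · simp [ht]
  · obtain ⟨p, hp⟩ := SimpleGraph.exists_walk_of_edist_ne_top ht
    rw [← hp, ← SimpleGraph.Walk.length_map φ p]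
    exact SimpleGraph.edist_le _

theorem relDist_one_inv_mul_le {i : ι} (h k : H i) :
    relDist X H i 1 (h⁻¹ * k) ≤ relDist X H i h k := by
  simpa [relDist] using edist_deletedCayley_mul_left_le (X := X) h⁻¹ (h : G) (k : G)

theorem exists_nearest (X : Set G) (H : ι → Subgroup G) (i : ι) (g : G) :
    ∃ p : H i, ∀ z : H i, (cayley X H).dist g p ≤ (cayley X H).dist g z :=
  ⟨Function.argmin fun z : H i => (cayley X H).dist g z,
    fun z => Function.argmin_le (fun z : H i => (cayley X H).dist g z) z⟩

/-- A nearest point of `H i`, with respect to the metric of the Cayley graph. -/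
noncomputable def proj (X : Set G) (H : ι → Subgroup G) (i : ι) (g : G) : H i :=
  (exists_nearest X H i g).choose

theorem dist_proj_le (i : ι) (g : G) (z : H i) :
    (cayley X H).dist g (proj X H i g) ≤ (cayley X H).dist g z :=
  (exists_nearest X H i g).choose_spec z

theorem proj_coe (hX : (cayley X H).Connected) (i : ι) (h : H i) : proj X H i h = h := by
  have h₁ : (cayley X H).dist (h : G) (proj X H i h) ≤ 0 := by
    simpa using dist_proj_le (X := X) i (h : G) h
  exact Subtype.ext (hX.dist_eq_zero_iff.1 (Nat.le_zero.1 h₁)).symm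

/-- Projections to a hyperbolically embedded subgroup `H i` of the end points of an edge outside
`H i` are uniformly close in the relative metric. -/
theorem IsHyperbolicallyEmbeddedWrt.exists_relDist_proj_le
    (hX : IsHyperbolicallyEmbeddedWrt X H) :
    ∃ D : ℕ, ∀ (i : ι) (g : G) (a : Letter X H), ¬ IsSubgroupEdge i g a →
      relDist X H i (proj X H i g) (proj X H i (g * a.val)) ≤ D := by
  obtain ⟨δ, hδ⟩ := hX.hyperbolic
  refine ⟨8 * δ + 10, fun i g a ha => ?_⟩
  refine (connected_cayley hX.generates).edist_nearest_le hδ (A := (H i : Set G)) ?_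
    (fun x y => deletedCayley_adj_of_not_mem) (dist_cayley_mul_le_one g a)
    (edist_deletedCayley_mul_le_one ha) (proj X H i g).2
    (fun z hz => dist_proj_le i g ⟨z, hz⟩) (proj X H i (g * a.val)).2
    (fun z hz => dist_proj_le i (g * a.val) ⟨z, hz⟩)
  intro x hx y hy
  have := dist_cayley_mul_le_one (X := X) x
    (Sum.inr ⟨i, ⟨x⁻¹ * y, mul_mem (inv_mem hx) hy⟩⟩ : Letter X H)
  simpa [Letter.val] using this

variable {R : ι → Type v} [∀ i, MetricSpace (R i)] [∀ i, MulAction (H i) (R i)]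
  [∀ i, IsIsometricSMul (H i) (R i)]

/-- On an orbit of `H i`, the projections of the end points of an edge outside `H i` are uniformly
close. -/
theorem IsHyperbolicallyEmbeddedWrt.exists_dist_proj_smul_le
    (hX : IsHyperbolicallyEmbeddedWrt X H) (i : ι) (x : R i) :
    ∃ M : ℝ, ∀ (g : G) (a : Letter X H), ¬ IsSubgroupEdge i g a →
      dist (proj X H i g • x) (proj X H i (g * a.val) • x) ≤ M := by
  obtain ⟨D, hD⟩ := hX.exists_relDist_proj_le
  obtain ⟨M, hM⟩ := ((hX.proper i 1 D).image fun k : H i => dist x (k • x)).bddAbove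
  refine ⟨M, fun g a ha => ?_⟩
  have h := hM ⟨_, (relDist_one_inv_mul_le _ _).trans (hD i g a ha), rfl⟩
  dsimp only at h
  rwa [← dist_smul (proj X H i g), smul_smul, mul_inv_cancel_left] at h

/-- Let `x i` be points of the spaces in a subfamily. Moving `g` by a fixed element `u` of
`G` moves the points `proj X H i g • x i` by a bounded amount, uniformly in `g` and `i`. -/
theorem IsHyperbolicallyEmbeddedWrt.exists_dist_proj_mul_smul_le
    (hX : IsHyperbolicallyEmbeddedWrt X H) {s : Set ι} (x : ∀ i : s, R i) {M : ℝ}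
    (hM : ∀ (i : s) (g : G) (a : Letter X H), ¬ IsSubgroupEdge (i : ι) g a →
      dist (proj X H i g • x i) (proj X H i (g * a.val) • x i) ≤ M) (u : G) :
    ∃ B : ℝ, ∀ (i : s) (g : G),
      dist (proj X H i g • x i) (proj X H i (g * u) • x i) ≤ B := by
  have hM' : ∀ (i : s) (g u : G) (a : Letter X H), a.val = u → ¬ IsSubgroupEdge (i : ι) g a →
      dist (proj X H i g • x i) (proj X H i (g * u) • x i) ≤ M := by
    rintro i g _ a rfl
    exact hM i g a
  have hu : u ∈ Subgroup.closure (X ∪ ⋃ i, (H i : Set G)) := hX.generates ▸ Subgroup.mem_top u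
  induction hu using Subgroup.closure_induction with
  | mem u hu =>
    rcases hu with hu | hu
    · exact ⟨M, fun i g => hM' i g u (Sum.inl ⟨u, hu⟩) rfl (by simp [IsSubgroupEdge])⟩
    · obtain ⟨j, hj⟩ := Set.mem_iUnion.1 hu
      by_cases hjs : j ∈ s
      -- Only edges inside `H j` escape the bound `M`. There the projection is the identity, and the
      -- displacement is that of `x j` under `u`, whatever `g` is.
      · refine ⟨max M (dist (x ⟨j, hjs⟩) ((⟨u, hj⟩ : H j) • x ⟨j, hjs⟩)), fun i g => ?_⟩
        by_cases he : IsSubgroupEdge (i : ι) g (Sum.inr ⟨j, u, hj⟩ : Letter X H)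
        · obtain ⟨i, hi⟩ := i
          obtain ⟨hg, h, hjh⟩ := he
          obtain rfl : j = i := congrArg Sigma.fst (Sum.inr.inj hjh)
          have hc := connected_cayley hX.generates
          have h₁ : proj X H j g = ⟨g, hg⟩ := proj_coe hc j ⟨g, hg⟩
          have h₂ : proj X H j (g * u) = (⟨g, hg⟩ : H j) * ⟨u, hj⟩ :=
            proj_coe hc j ((⟨g, hg⟩ : H j) * ⟨u, hj⟩)
          refine le_max_of_le_right ?_
          simp only [h₁, h₂, mul_smul, dist_smul, le_refl]
        · exact le_max_of_le_left (hM' i g u _ rfl he)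
      · refine ⟨M, fun i g => hM' i g u (Sum.inr ⟨j, u, hj⟩) rfl ?_⟩
        rintro ⟨-, h, hjh⟩
        obtain rfl : j = i := congrArg Sigma.fst (Sum.inr.inj hjh)
        exact hjs i.2
  | one => exact ⟨0, by simp⟩
  | mul u v _ _ hu hv =>
    obtain ⟨B, hB⟩ := hu
    obtain ⟨C, hC⟩ := hv
    refine ⟨B + C, fun i g => ?_⟩
    rw [← mul_assoc]
    exact (dist_triangle _ _ _).trans (add_le_add (hB i g) (hC i (g * u)))
  | inv u _ hu =>
    obtain ⟨B, hB⟩ := hu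
    refine ⟨B, fun i g => ?_⟩
    simpa [dist_comm] using hB i (g * u⁻¹)

end Cayley

/-! ### The extended action -/

section Induced

variable {H : ι → Subgroup G} {R : ι → Type v}

/-- The disjoint union of the spaces `G × R i`, on which `G` acts by left translations. -/
structure Induced (G : Type u) {ι : Type w} (R : ι → Type v) : Type (max u v w) where
  /-- the component -/
  idx : ι
  /-- the group coordinate -/
  elt : G
  /-- the space coordinate -/
  pt : R idx

instance : MulAction G (Induced G R) where
  smul g y := ⟨y.idx, g * y.elt, y.pt⟩
  one_smul y := by
    change Induced.mk _ (1 * y.elt) _ = y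
    rw [one_mul]
  mul_smul g k y := by
    change Induced.mk y.idx (g * k * y.elt) y.pt = Induced.mk y.idx (g * (k * y.elt)) y.pt
    rw [mul_assoc]

theorem smul_induced_mk (g k : G) (i : ι) (x : R i) :
    g • (⟨i, k, x⟩ : Induced G R) = ⟨i, g * k, x⟩ :=
  rfl

variable [∀ i, MulAction (H i) (R i)] (π : ∀ k, G → H k) (r : ∀ k, R k)

open Classical in
/-- The coordinate of a point of `Induced G R` in `R k`: the points over `H k` in the component
`k` act on the space coordinate, all others are projected to the orbit of `r k`. -/
noncomputable def coord (k : ι) (y : Induced G R) : R k :=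
  if h : y.idx = k ∧ y.elt ∈ H k then (⟨y.elt, h.2⟩ : H k) • (h.1 ▸ y.pt) else π k y.elt • r k

theorem coord_of_mem {k : ι} {g : G} (hg : g ∈ H k) (x : R k) :
    coord π r k ⟨k, g, x⟩ = (⟨g, hg⟩ : H k) • x :=
  dif_pos ⟨rfl, hg⟩

theorem coord_of_not {i k : ι} {g : G} (h : ¬ (i = k ∧ g ∈ H k)) (x : R i) :
    coord π r k ⟨i, g, x⟩ = π k g • r k :=
  dif_neg h

variable [∀ i, MetricSpace (R i)]

/-- The distance of `y` and `z` in `Induced G R`: the largest distance between the coordinates of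
a translate of the two points. -/
noncomputable def inducedDist (y z : Induced G R) : ℝ :=
  ⨆ q : G × ι, dist (coord π r q.2 (q.1 • y)) (coord π r q.2 (q.1 • z))

variable {π r}

theorem inducedDist_le {y z : Induced G R} {C : ℝ} (hC : 0 ≤ C)
    (h : ∀ (g : G) (k : ι), dist (coord π r k (g • y)) (coord π r k (g • z)) ≤ C) :
    inducedDist π r y z ≤ C :=
  Real.iSup_le (fun q => h q.1 q.2) hC

variable [∀ i, IsIsometricSMul (H i) (R i)]

/-- The bound does not depend on `k` or `g`, so coordinates can be replaced by projected base points
uniformly over all translates. -/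
theorem dist_coord_le (hπ : ∀ k (h : H k), π k h = h) (k i : ι) (g : G) (x : R i) :
    dist (coord π r k ⟨i, g, x⟩) (π k g • r k) ≤ dist x (r i) := by
  by_cases h : i = k ∧ g ∈ H k
  · obtain ⟨rfl, hg⟩ := h
    have h₁ : π i g = ⟨g, hg⟩ := hπ i ⟨g, hg⟩
    rw [coord_of_mem π r hg, h₁, dist_smul]
  · rw [coord_of_not π r h, dist_self]
    exact dist_nonneg

/-- Needed since an unbounded real supremum has the default value `0`. Translates of `g` and `k`
always differ by the same right factor `g⁻¹ * k`. -/
theorem bddAbove_dist_coord (hπ : ∀ k (h : H k), π k h = h)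
    (hB : ∀ u : G, ∃ B : ℝ, ∀ k g, dist (π k g • r k) (π k (g * u) • r k) ≤ B)
    (y z : Induced G R) :
    BddAbove (Set.range fun q : G × ι =>
      dist (coord π r q.2 (q.1 • y)) (coord π r q.2 (q.1 • z))) := by
  obtain ⟨i, g, x⟩ := y
  obtain ⟨j, k, x'⟩ := z
  obtain ⟨B, hB⟩ := hB (g⁻¹ * k)
  refine ⟨dist x (r i) + B + dist x' (r j), ?_⟩
  rintro _ ⟨⟨γ, l⟩, rfl⟩
  simp only [smul_induced_mk]
  have h₁ := dist_coord_le (r := r) hπ l i (γ * g) x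
  have h₂ := dist_coord_le (r := r) hπ l j (γ * k) x'
  have h₃ := hB l (γ * g)
  rw [show γ * g * (g⁻¹ * k) = γ * k by group] at h₃
  rw [dist_comm] at h₂
  exact (dist_triangle4 _ _ _ _).trans (add_le_add (add_le_add h₁ h₃) h₂)

theorem exists_isExtension_of_projections (hπ : ∀ k (h : H k), π k h = h) {M : ℝ}
    (hM : ∀ k g i (h : H i), ¬ (i = k ∧ g ∈ H k) →
      dist (π k g • r k) (π k (g * h) • r k) ≤ M)
    (hB : ∀ u : G, ∃ B : ℝ, ∀ k g, dist (π k g • r k) (π k (g * u) • r k) ≤ B) :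
    ∃ (S : Type (max u v w)) (_ : MetricSpace S) (_ : MulAction G S) (_ : IsIsometricSMul G S),
      IsExtension H R S := by
  have hle : ∀ (y z : Induced G R) (g : G) (k : ι),
      dist (coord π r k (g • y)) (coord π r k (g • z)) ≤ inducedDist π r y z :=
    fun y z g k => le_ciSup (bddAbove_dist_coord hπ hB y z) (g, k)
  have hnonneg : ∀ y z : Induced G R, 0 ≤ inducedDist π r y z :=
    fun y z => Real.iSup_nonneg fun _ => dist_nonneg
  let _ : PseudoMetricSpace (Induced G R) :=
    { dist := inducedDist π r
      dist_self := fun y => by simp [inducedDist]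
      dist_comm := fun y z => by simp only [inducedDist, dist_comm]
      dist_triangle := fun x y z => inducedDist_le (add_nonneg (hnonneg _ _) (hnonneg _ _))
        fun g k => (dist_triangle _ _ _).trans (add_le_add (hle x y g k) (hle y z g k)) }
  have hdist : ∀ y z : Induced G R, dist y z = inducedDist π r y z := fun _ _ => rfl
  have hsmul_le : ∀ (g : G) (y z : Induced G R), dist (g • y) (g • z) ≤ dist y z :=
    fun g y z => inducedDist_le (hnonneg y z) fun k l => by
      rw [smul_smul, smul_smul]
      exact hle y z (k * g) l
  have : IsIsometricSMul G (Induced G R) :=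
    ⟨fun g => Isometry.of_dist_eq fun y z => le_antisymm (hsmul_le g y z) <| by
      simpa using hsmul_le g⁻¹ (g • y) (g • z)⟩
  -- Distinct points may share all coordinates, hence the passage to the quotient.
  have hiso : IsIsometricSMul G (SeparationQuotient (Induced G R)) := by
    refine ⟨fun g => Isometry.of_dist_eq fun y z => ?_⟩
    obtain ⟨y, rfl⟩ := SeparationQuotient.surjective_mk y
    obtain ⟨z, rfl⟩ := SeparationQuotient.surjective_mk z
    rw [← SeparationQuotient.mk_smul, ← SeparationQuotient.mk_smul, SeparationQuotient.dist_mk,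
      SeparationQuotient.dist_mk, dist_smul]
  refine ⟨SeparationQuotient (Induced G R), inferInstance, inferInstance, hiso, fun i =>
    ⟨fun x => SeparationQuotient.mk ⟨i, 1, x⟩, fun x => ⟨max M 0, ?_⟩, 1, one_pos, fun x y => ?_⟩⟩
  · rintro _ ⟨h, rfl⟩
    change dist _ ((h : G) • SeparationQuotient.mk (Induced.mk i 1 x)) ≤ _
    rw [← SeparationQuotient.mk_smul, SeparationQuotient.dist_mk, hdist]
    refine inducedDist_le (le_max_right _ _) fun g k => ?_
    simp only [smul_induced_mk, mul_one]
    by_cases hg : i = k ∧ g ∈ H k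
    · obtain ⟨rfl, hg⟩ := hg
      rw [coord_of_mem π r hg, coord_of_mem π r (mul_mem hg h.2), smul_smul]
      exact (dist_self _).trans_le (le_max_right _ _)
    -- Both coordinates are projected base points, of the ends of an edge labelled by `h`.
    · have hg' : ¬ (i = k ∧ g * h ∈ H k) := by
        rintro ⟨rfl, hgh⟩
        exact hg ⟨rfl, ((H i).mul_mem_cancel_right h.2).1 hgh⟩
      rw [coord_of_not π r hg, coord_of_not π r hg']
      exact (hM k g i h hg).trans (le_max_left _ _)
  · rw [SeparationQuotient.dist_mk, hdist]
    constructor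
    -- The trivial translate and the coordinate `i` already recover `dist x y`.
    · have h₁ := hle ⟨i, 1, x⟩ ⟨i, 1, y⟩ 1 i
      rw [one_smul, one_smul, coord_of_mem π r (one_mem _), coord_of_mem π r (one_mem _),
        dist_smul] at h₁
      linarith
    · refine (inducedDist_le dist_nonneg fun g k => ?_ : _ ≤ dist x y).trans (by linarith)
      simp only [smul_induced_mk, mul_one]
      by_cases hg : i = k ∧ g ∈ H k
      · obtain ⟨rfl, hg⟩ := hg
        rw [coord_of_mem π r hg, coord_of_mem π r hg, dist_smul]
      · rw [coord_of_not π r hg, coord_of_not π r hg, dist_self]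
        exact dist_nonneg

end Induced

theorem IsHyperbolicallyEmbedded.extensionProblemSolvable [Finite ι] {H : ι → Subgroup G}
    (hH : IsHyperbolicallyEmbedded H) : ExtensionProblemSolvable.{u, v, w} H := by
  intro R _ _ _
  obtain ⟨X, hX⟩ := hH
  -- Empty spaces have no base point. Their subgroups still contribute letters to the alphabet.
  let s : Set ι := {i | Nonempty (R i)}
  let r : ∀ i : s, R i := fun i => i.2.some
  choose M hM using fun i : s => hX.exists_dist_proj_smul_le i.1 (r i)
  -- Finiteness of the family makes the bound uniform in `i`.
  obtain ⟨B, hB⟩ := (Set.finite_range M).bddAbove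
  have hMB : ∀ (i : s) (g : G) (a : Letter X H), ¬ IsSubgroupEdge (i : ι) g a →
      dist (proj X H i g • r i) (proj X H i (g * a.val) • r i) ≤ B :=
    fun i g a ha => (hM i g a ha).trans (hB ⟨i, rfl⟩)
  obtain ⟨S, _, _, _, hS⟩ := exists_isExtension_of_projections
    (H := fun i : s => H i) (R := fun i : s => R i) (π := fun i : s => proj X H i) (r := r)
    (fun k => proj_coe (connected_cayley hX.generates) (k : ι))
    (fun k g i h hki => hMB k g (Sum.inr ⟨i, h⟩) <| by
      rintro ⟨hg, h', e⟩
      exact hki ⟨Subtype.ext (congrArg Sigma.fst (Sum.inr.inj e)), hg⟩)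
    (hX.exists_dist_proj_mul_smul_le r hMB)
  refine ⟨S, inferInstance, inferInstance, inferInstance, fun i => ?_⟩
  by_cases hi : Nonempty (R i)
  · exact hS ⟨i, hi⟩
  · rw [not_nonempty_iff] at hi
    exact ⟨isEmptyElim, isEmptyElim, 1, one_pos, isEmptyElim⟩

end HypEmb

theorem mainTheorem1 {G : Type u} [Group G] {n : ℕ} (H : Fin n → Subgroup G)
    (hH : HypEmb.IsHyperbolicallyEmbedded H) :
    HypEmb.ExtensionProblemSolvable.{u, v, 0} H :=
  hH.extensionProblemSolvable
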